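/- All graphs are connected and simple. A permutation group on a set $\Omega$ is a subgroup of $\mathrm{Sym}(\Omega)$; it is semiregular if only its identity element fixes a point, and semiprimitive if each of its normal subgroups is transitive or semiregular. Let $\Gamma$ be a graph and let $G$ be a group of automorphisms of $\Gamma$. For a vertex $v$, let $\Gamma(v)$ be its neighbourhood, $G_v$ its stabiliser in $G$, and $G_v^{\Gamma(v)}$ the permutation group that $G_v$ induces on $\Gamma(v)$. For an edge $\{u,v\}$ put $G_{uv}=G_u\cap G_v$. The graph $\Gamma$ is $G$-locally-transitive if $G_v^{\Gamma(v)}$ is transitive for every vertex $v$. In that case, $(\Gamma,G)$ is locally $[L_1,L_2]$ if for some edge $\{u,v\}$ there are permutation isomorphisms $G_u^{\Gamma(u)}\cong L_1$ and $G_v^{\Gamma(v)}\cong L_2$. The multiset $[L_1,L_2]$ is locally-restrictive if there is a constant $c\in\mathbb N$ such that $|G_{uv}|\le c$ whenever $\Gamma$ is a finite $G$-locally-transitive graph with $(\Gamma,G)$ locally $[L_1,L_2]$ and $\{u,v\}$ is an edge of $\Gamma$. **Theorem.** Let $L_1$ and $L_2$ be nontrivial finite transitive permutation groups. If at least one of $L_1$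 and $L_2$ is not semiprimitive, then $[L_1,L_2]$ is not locally-restrictive. That is, for every $c\in\mathbb N$ there are a finite graph $\Gamma$, a group $G$ of automorphisms of $\Gamma$ and an edge $\{u,v\}$ of $\Gamma$ such that $\Gamma$ is $G$-locally-transitive, $(\Gamma,G)$ is locally $[L_1,L_2]$ and $|G_{uv}|>c$. -/

import Mathlib

namespace LocRes

/-- An action is semiregular if the identity is the only element of the group
that fixes a point. -/
def IsSemiregular (G Ω : Type*) [Group G] [MulAction G Ω] : Prop :=
  ∀ (g : G) (ω : Ω), g • ω = ω → g = 1

/-- A permutation group `L ≤ Sym(Ω)` is semiprimitive if each of its normal subgroups is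
either transitive or semiregular on `Ω`. -/
def IsSemiprimitive {Ω : Type*} (L : Subgroup (Equiv.Perm Ω)) : Prop :=
  ∀ K : Subgroup L, K.Normal → MulAction.IsPretransitive K Ω ∨ IsSemiregular K Ω

/-- Permutation isomorphism of permutation groups `L ≤ Sym(Ω)` and `M ≤ Sym(Ω')`: some bijection
`e : Ω → Ω'` carries `L` onto `M` by `σ ↦ e σ e⁻¹`. -/
def PermIsomorphic {Ω Ω' : Type*} (L : Subgroup (Equiv.Perm Ω))
    (M : Subgroup (Equiv.Perm Ω')) : Prop :=
  ∃ e : Ω ≃ Ω', ∀ σ : Equiv.Perm Ω, σ ∈ L ↔ e.permCongr σ ∈ M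

section Graph

variable {V : Type*} {Γ : SimpleGraph V}

/-- The action of the vertex stabiliser `G_v` on the neighbourhood `Γ(v)`, where `G` is a group of
automorphisms of `Γ`. -/
def localHom (G : Subgroup (Γ ≃g Γ)) (v : V) :
    MulAction.stabilizer G v →* Equiv.Perm (Γ.neighborSet v) where
  toFun g :=
    { toFun := fun w => ⟨(g : G) • (w : V), by
        have h := (SimpleGraph.Iso.map_adj_iff (g : G).1).2 w.2
        have hg : (g : G).1 v = v := g.2
        rw [hg] at h
        exact h⟩
      invFun := fun w => ⟨(g⁻¹ : G) • (w : V), by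
        have h := (SimpleGraph.Iso.map_adj_iff ((g : G)⁻¹).1).2 w.2
        have hg : ((g : G)⁻¹).1 v = v := (g⁻¹).2
        rw [hg] at h
        exact h⟩
      left_inv := fun w => Subtype.ext (inv_smul_smul (g : G) (w : V))
      right_inv := fun w => Subtype.ext (smul_inv_smul (g : G) (w : V)) }
  map_one' := Equiv.ext fun w => Subtype.ext (one_smul G (w : V))
  map_mul' g h := Equiv.ext fun w => Subtype.ext (mul_smul (g : G) (h : G) (w : V))

/-- The permutation group `G_v^{Γ(v)}` induced by `G_v` on `Γ(v)`. -/
def localGroup (G : Subgroup (Γ ≃g Γ)) (v : V) : Subgroup (Equiv.Perm (Γ.neighborSet v)) :=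
  (localHom G v).range

/-- `Γ` is `G`-locally-transitive: `G_v^{Γ(v)}` is transitive for every vertex `v`. -/
def IsLocallyTransitive (G : Subgroup (Γ ≃g Γ)) : Prop :=
  ∀ v : V, MulAction.IsPretransitive (localGroup G v) (Γ.neighborSet v)

/-- The pair `(Γ, G)` is locally `[L₁, L₂]`: `G_u^{Γ(u)} ≅ L₁` and `G_v^{Γ(v)} ≅ L₂` as permutation
groups for some edge `{u, v}` (with its ends in either order, as adjacency is symmetric). -/
def IsLocally {Ω₁ Ω₂ : Type*} (G : Subgroup (Γ ≃g Γ))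
    (L₁ : Subgroup (Equiv.Perm Ω₁)) (L₂ : Subgroup (Equiv.Perm Ω₂)) : Prop :=
  ∃ u v : V, Γ.Adj u v ∧
    PermIsomorphic (localGroup G u) L₁ ∧ PermIsomorphic (localGroup G v) L₂

/-- `G_{uv} = G_u ∩ G_v`. -/
def edgeStabilizer (G : Subgroup (Γ ≃g Γ)) (u v : V) : Subgroup G :=
  MulAction.stabilizer G u ⊓ MulAction.stabilizer G v

end Graph

/-- `[L₁, L₂]` is locally-restrictive: there is a constant `c` with `|G_{uv}| ≤ c` for every finite
(connected, simple) `G`-locally-transitive graph `Γ` such that `(Γ, G)` is locally `[L₁, L₂]` and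
every edge `{u, v}` of `Γ`. -/
def IsLocallyRestrictive {Ω₁ Ω₂ : Type*}
    (L₁ : Subgroup (Equiv.Perm Ω₁)) (L₂ : Subgroup (Equiv.Perm Ω₂)) : Prop :=
  ∃ c : ℕ, ∀ (V : Type) [Finite V] (Γ : SimpleGraph V) (G : Subgroup (Γ ≃g Γ)),
    Γ.Connected → IsLocallyTransitive G → IsLocally G L₁ L₂ →
      ∀ u v : V, Γ.Adj u v → Nat.card (edgeStabilizer G u v) ≤ c

end LocRes

/-!
The idea is to build, from a normal subgroup `K` of `L₁` that is neither transitive nor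
semiregular, finite groups `A` and `B` in a common overgroup such that `A` acts on the cosets of
`C = A ∩ B` in `A` as `L₁`, `B` acts on those in `B` as `L₂`, and `C` contains a large direct power
of a group `D ≠ 1` that meets trivially every subgroup of `C` normalised by `A` and `B`. The coset
graph of `⟨A, B⟩` with respect to `A` and `B` is then locally `[L₁, L₂]` with large edge stabilisers
(`exists_locally_of_subgroups`). Here `D` is the stabiliser of a point in the kernel of the action of
`L₁` on the set of `K`-orbits; for a suitable point it is nontrivial because `K` is not semiregular.

Let `X` be the set of `K`-orbits, with a marked point `s x` in each orbit `x`, let `Y` be the set on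
which `L₂` acts, and fix `x₀ ∈ X` and `y₀ ∈ Y`. Take many copies of `X × Y` and one further point
`none`, which is placed over `x₀`. The groups `A` and `B` live in the wreath product of `L₁` with
the symmetric group of this index set `Z`; all components of an element are congruent modulo the
kernel of the action on `X`, so an element induces a permutation `q` of `X`, and it comes with
`μ ∈ L₂`.

* In `A`, the element `μ` fixes `y₀`, the pair `(q, μ)` acts naturally on `Z`, and marked points are
  mapped to marked points except in the fibre over `none`. The component at `none` is the
  homomorphism onto `L₁`.
* In `B`, the permutation `q` fixes `x₀`, the pair `(q, μ)` acts on `Z` by the natural action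
  conjugated by the cycle `none ↦ (x₀, y₀, 0) ↦ (x₀, y₀, 1) ↦ … ↦ none`, and all marked points are
  mapped to marked points. Here `μ` is the homomorphism onto `L₂`.

The cycle commutes with `(q, μ)` if `q` fixes `x₀` and `μ` fixes `y₀`, so `A ∩ B` is the preimage of
a point stabiliser both in `A` and in `B`. Components are tied together only modulo the kernel on
`X`, so `D` acts independently in the different fibres; and as this kernel is transitive on each
`K`-orbit, every permutation of `X` induced by `L₁` lifts to a component that respects the marked
points, which makes `A` map onto `L₁`. The conjugation by the cycle makes `A` and `B` link
consecutive points of it (`gridLine_step`); this uses `X ≠ {x₀}`, that is, the intransitivity of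
`K`, and the nontriviality of `L₂`. A subgroup of `A ∩ B` normalised by `A` and
`B` acts at `none` by a normal subgroup of `L₁` inside a point stabiliser, hence trivially, and by
linking trivially at every point of the cycle (`val_gridLine_eq_one`), so that it meets the copies
of `D` placed there trivially.
-/

namespace LocRes

/-! ### Local groups and coset graphs -/

section LocalAction

theorem exists_mem_apply_eq {Ω : Type*} {L : Subgroup (Equiv.Perm Ω)}
    (h : MulAction.IsPretransitive L Ω) (ω ω' : Ω) : ∃ σ ∈ L, σ ω = ω' :=
  let ⟨σ, hσ⟩ := h.exists_smul_eq ω ω'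
  ⟨σ, σ.2, hσ⟩

variable {V G Ω : Type*} {Γ : SimpleGraph V} [Group G]

/-- If `G` acts on `Γ` through `φ`, the stabiliser of `u` is transitive on `Γ(u) ∋ v`, and `α`
describes an action of this stabiliser on `Ω` in which the stabiliser of `ω` is the stabiliser
of `v`, then the local group at `u` is the group induced on `Ω`. -/
theorem permIsomorphic_localGroup (φ : G →* (Γ ≃g Γ)) {u v : V} (huv : Γ.Adj u v)
    {L : Subgroup (Equiv.Perm Ω)} (ω : Ω) (α : G → Equiv.Perm Ω)
    (hmul : ∀ a b, φ a u = u → φ b u = u → α (a * b) = α a * α b)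
    (hL : ∀ σ, σ ∈ L ↔ ∃ a, φ a u = u ∧ α a = σ)
    (htrans : ∀ ω', ∃ σ ∈ L, σ ω = ω')
    (hnb : ∀ w, Γ.Adj u w → ∃ a, φ a u = u ∧ φ a v = w)
    (hstab : ∀ a, φ a u = u → (φ a v = v ↔ α a ω = ω)) :
    PermIsomorphic (localGroup φ.range u) L := by
  have hφmul : ∀ a b x, φ (a * b) x = φ a (φ b x) := fun a b x => by rw [map_mul]; rfl
  have hinv : ∀ a, φ a u = u → φ a⁻¹ u = u := fun a ha => by
    conv_lhs => rw [← ha]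
    rw [← hφmul, inv_mul_cancel, map_one]; rfl
  have hone : α 1 = 1 := by
    have h1 : φ 1 u = u := by rw [map_one]; rfl
    have := hmul 1 1 h1 h1
    rw [mul_one] at this
    exact left_eq_mul.mp this
  have key : ∀ a b, φ a u = u → φ b u = u → (φ a v = φ b v ↔ α a ω = α b ω) := by
    intro a b ha hb
    have h := hstab (b⁻¹ * a) (by rw [hφmul, ha, hinv b hb])
    have hαi : α b⁻¹ * α b = 1 := by rw [← hmul _ _ (hinv b hb) hb, inv_mul_cancel, hone]
    rw [hφmul, hmul _ _ (hinv b hb) ha, eq_inv_of_mul_eq_one_left hαi, Equiv.Perm.mul_apply,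
      Equiv.Perm.inv_eq_iff_eq] at h
    rw [← h]
    constructor
    · intro e
      rw [e, ← hφmul, inv_mul_cancel, map_one]; rfl
    · intro e
      have := congrArg (φ b) e
      rwa [← hφmul, mul_inv_cancel, map_one] at this
  have hnb' : ∀ w : Γ.neighborSet u, ∃ a, φ a u = u ∧ φ a v = w := fun w => hnb w w.2
  choose a hau hav using hnb'
  let f : Γ.neighborSet u → Ω := fun w => α (a w) ω
  have hadj : ∀ b, φ b u = u → Γ.Adj u (φ b v) := fun b hb => by
    have := (SimpleGraph.Iso.map_adj_iff (φ b)).2 huv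
    rwa [hb] at this
  have hf : ∀ b (hb : φ b u = u), f ⟨φ b v, hadj b hb⟩ = α b ω := fun b hb =>
    (key _ _ (hau _) hb).1 (hav _)
  have hfb : Function.Bijective f := by
    constructor
    · intro w w' h
      have := (key _ _ (hau w) (hau w')).2 h
      rw [hav, hav] at this
      exact Subtype.ext this
    · intro ω'
      obtain ⟨σ, hσ, rfl⟩ := htrans ω'
      obtain ⟨b, hb, rfl⟩ := (hL σ).1 hσ
      exact ⟨_, hf b hb⟩
  let e := Equiv.ofBijective f hfb
  have main : ∀ b (hb : φ b u = u),
      e.permCongr (localHom φ.range u ⟨⟨φ b, b, rfl⟩, hb⟩) = α b := by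
    intro b hb
    ext ω'
    obtain ⟨w, rfl⟩ := e.surjective ω'
    rw [Equiv.permCongr_apply, Equiv.symm_apply_apply]
    have hw : w = ⟨φ (a w) v, hadj _ (hau w)⟩ := Subtype.ext (hav w).symm
    have h1 : localHom φ.range u ⟨⟨φ b, b, rfl⟩, hb⟩ w =
        ⟨φ (b * a w) v, hadj _ (by rw [hφmul, hau, hb])⟩ := by
      refine Subtype.ext ?_
      change φ b w = φ (b * a w) v
      rw [hφmul, hav]
    rw [h1]
    change f _ = α b (f w)
    rw [hf _ (by rw [hφmul, hau, hb]), hmul _ _ hb (hau _)]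
    rfl
  refine ⟨e, fun σ => ?_⟩
  rw [hL]
  constructor
  · rintro ⟨⟨⟨_, b, rfl⟩, hb⟩, rfl⟩
    exact ⟨b, hb, (main b hb).symm⟩
  · rintro ⟨b, hb, h⟩
    exact ⟨⟨⟨φ b, b, rfl⟩, hb⟩, e.permCongr.injective ((main b hb).trans h)⟩

end LocalAction

section CosetGraph

variable {G : Type*} [Group G]

/-- The bipartite graph on the left cosets of `A` and `B` in which the coset `gA` is joined to
`gB` for every `g`. -/
def cosetGraph (A B : Subgroup G) : SimpleGraph ((G ⧸ A) ⊕ (G ⧸ B)) where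
  Adj x y := (∃ g : G, x = .inl g ∧ y = .inr g) ∨ ∃ g : G, x = .inr g ∧ y = .inl g
  symm := ⟨by
    rintro x y (⟨g, rfl, rfl⟩ | ⟨g, rfl, rfl⟩)
    exacts [.inr ⟨g, rfl, rfl⟩, .inl ⟨g, rfl, rfl⟩]⟩
  loopless := ⟨by rintro x (⟨g, rfl, h⟩ | ⟨g, rfl, h⟩) <;> simp at h⟩

theorem cosetGraph_adj_smul {A B : Subgroup G} (g : G) {x y : (G ⧸ A) ⊕ (G ⧸ B)}
    (h : (cosetGraph A B).Adj x y) : (cosetGraph A B).Adj (g • x) (g • y) := by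
  obtain (⟨k, rfl, rfl⟩ | ⟨k, rfl, rfl⟩) := h
  exacts [.inl ⟨g * k, rfl, rfl⟩, .inr ⟨g * k, rfl, rfl⟩]

/-- The action of `G` on its coset graph by left multiplication. -/
def cosetGraphHom (A B : Subgroup G) : G →* (cosetGraph A B ≃g cosetGraph A B) where
  toFun g :=
    { MulAction.toPerm g with
      map_rel_iff' := fun {x y} => ⟨fun h => by
        have := cosetGraph_adj_smul g⁻¹ h
        rwa [MulAction.toPerm_apply, MulAction.toPerm_apply, inv_smul_smul, inv_smul_smul] at this, fun h => cosetGraph_adj_smul g h⟩ }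
  map_one' := RelIso.ext fun x => one_smul G x
  map_mul' g k := RelIso.ext fun x => mul_smul g k x

@[simp] theorem cosetGraphHom_apply {A B : Subgroup G} (g : G) (x : (G ⧸ A) ⊕ (G ⧸ B)) :
    cosetGraphHom A B g x = g • x := rfl

theorem cosetGraph_connected {A B : Subgroup G} (h : A ⊔ B = ⊤) : (cosetGraph A B).Connected := by
  have hlr : ∀ g : G, (cosetGraph A B).Adj (.inl g) (.inr g) := fun g => .inl ⟨g, rfl, rfl⟩
  have hl : ∀ g : G, (cosetGraph A B).Reachable (.inl ((1 : G) : G ⧸ A)) (.inl (g : G ⧸ A)) := by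
    intro g
    have hg : g ∈ Subgroup.closure ((A : Set G) ∪ B) := by
      rw [← Subgroup.sup_eq_closure, h]; trivial
    have step : ∀ x y : G, y ∈ (A : Set G) ∪ B →
        (cosetGraph A B).Reachable (.inl (x : G ⧸ A)) (.inl ((x * y : G) : G ⧸ A)) := by
      rintro x y (hy | hy)
      · rw [QuotientGroup.mk_mul_of_mem x hy]
      · have h2 := (hlr (x * y)).symm
        rw [QuotientGroup.mk_mul_of_mem x hy] at h2
        exact (hlr x).reachable.trans h2.reachable
    induction hg using Subgroup.closure_induction_right with
    | one => exact .refl _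
    | mul_right x _ y hy ih => exact ih.trans (step x y hy)
    | mul_inv_cancel x _ y hy ih =>
      refine ih.trans (step x y⁻¹ ?_)
      rcases hy with hy | hy
      exacts [.inl (A.inv_mem hy), .inr (B.inv_mem hy)]
  have hall : ∀ x, (cosetGraph A B).Reachable (.inl ((1 : G) : G ⧸ A)) x := by
    rintro (x | x) <;> obtain ⟨g, rfl⟩ := QuotientGroup.mk_surjective x
    · exact hl g
    · exact (hl g).trans (hlr g).reachable
  have : Nonempty ((G ⧸ A) ⊕ (G ⧸ B)) := ⟨.inl ((1 : G) : G ⧸ A)⟩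
  exact ⟨fun x y => (hall x).symm.trans (hall y)⟩

theorem cosetGraph_exists_smul {A B : Subgroup G} {w x y : (G ⧸ A) ⊕ (G ⧸ B)}
    (hx : (cosetGraph A B).Adj w x) (hy : (cosetGraph A B).Adj w y) :
    ∃ g : G, g • w = w ∧ g • x = y := by
  obtain (⟨k, rfl, rfl⟩ | ⟨k, rfl, rfl⟩) := hx <;>
    obtain (⟨l, hl, rfl⟩ | ⟨l, hl, rfl⟩) := hy
  · refine ⟨l * k⁻¹, ?_, ?_⟩
    · conv_rhs => rw [hl]
      change Sum.inl (((l * k⁻¹) * k : G) : G ⧸ A) = _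
      rw [inv_mul_cancel_right]
    · change Sum.inr (((l * k⁻¹) * k : G) : G ⧸ B) = _
      rw [inv_mul_cancel_right]
  · exact absurd hl Sum.inl_ne_inr
  · exact absurd hl Sum.inr_ne_inl
  · refine ⟨l * k⁻¹, ?_, ?_⟩
    · conv_rhs => rw [hl]
      change Sum.inr (((l * k⁻¹) * k : G) : G ⧸ B) = _
      rw [inv_mul_cancel_right]
    · change Sum.inl (((l * k⁻¹) * k : G) : G ⧸ A) = _
      rw [inv_mul_cancel_right]

theorem cosetGraph_isLocallyTransitive (A B : Subgroup G) :
    IsLocallyTransitive (cosetGraphHom A B).range := by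
  refine fun w => ⟨fun x y => ?_⟩
  obtain ⟨g, hw, hxy⟩ := cosetGraph_exists_smul x.2 y.2
  exact ⟨⟨_, ⟨⟨cosetGraphHom A B g, g, rfl⟩, hw⟩, rfl⟩, Subtype.ext hxy⟩

theorem smul_inl_one_eq_iff {A B : Subgroup G} (g : G) :
    g • (Sum.inl ((1 : G) : G ⧸ A) : (G ⧸ A) ⊕ (G ⧸ B)) = .inl ((1 : G) : G ⧸ A) ↔ g ∈ A := by
  change Sum.inl ((g * 1 : G) : G ⧸ A) = _ ↔ _
  rw [Sum.inl.injEq, mul_one, eq_comm, QuotientGroup.eq, inv_one, one_mul]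

theorem smul_inr_one_eq_iff {A B : Subgroup G} (g : G) :
    g • (Sum.inr ((1 : G) : G ⧸ B) : (G ⧸ A) ⊕ (G ⧸ B)) = .inr ((1 : G) : G ⧸ B) ↔ g ∈ B := by
  change Sum.inr ((g * 1 : G) : G ⧸ B) = _ ↔ _
  rw [Sum.inr.injEq, mul_one, eq_comm, QuotientGroup.eq, inv_one, one_mul]

/-- A finite group generated by subgroups `A` and `B` that act as `L₁` and `L₂` on the cosets of
`A ∩ B` gives a graph that is locally `[L₁, L₂]`; its edge stabilisers have order at least `|M|`
for every subgroup `M ≤ A ∩ B` that meets no nontrivial subgroup of `A ∩ B` normalised by `A` and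
`B`. The functions `α` and `β` matter on `A` and on `B` only. -/
theorem exists_locally_of_sup_eq_top {G : Type} [Group G] [Finite G] {Ω₁ Ω₂ : Type*}
    {L₁ : Subgroup (Equiv.Perm Ω₁)} {L₂ : Subgroup (Equiv.Perm Ω₂)}
    (ht₁ : MulAction.IsPretransitive L₁ Ω₁) (ht₂ : MulAction.IsPretransitive L₂ Ω₂)
    {A B : Subgroup G} (hAB : A ⊔ B = ⊤) (ω₁ : Ω₁) (ω₂ : Ω₂)
    (α : G → Equiv.Perm Ω₁) (β : G → Equiv.Perm Ω₂)
    (hα : ∀ a ∈ A, ∀ b ∈ A, α (a * b) = α a * α b)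
    (hβ : ∀ a ∈ B, ∀ b ∈ B, β (a * b) = β a * β b)
    (hαL : ∀ σ, σ ∈ L₁ ↔ ∃ a ∈ A, α a = σ) (hβL : ∀ σ, σ ∈ L₂ ↔ ∃ b ∈ B, β b = σ)
    (hαs : ∀ a ∈ A, (a ∈ B ↔ α a ω₁ = ω₁)) (hβs : ∀ b ∈ B, (b ∈ A ↔ β b ω₂ = ω₂))
    (M : Subgroup G) (hM : M ≤ A ⊓ B)
    (hcore : ∀ N : Subgroup G, N ≤ A ⊓ B → (∀ a ∈ A, ∀ x ∈ N, a * x * a⁻¹ ∈ N) →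
      (∀ b ∈ B, ∀ x ∈ N, b * x * b⁻¹ ∈ N) → N ⊓ M = ⊥) :
    ∃ (V : Type) (_ : Finite V) (Γ : SimpleGraph V) (H : Subgroup (Γ ≃g Γ)) (u v : V),
      Γ.Connected ∧ IsLocallyTransitive H ∧ IsLocally H L₁ L₂ ∧ Γ.Adj u v ∧
      Nat.card M ≤ Nat.card (edgeStabilizer H u v) := by
  let φ := cosetGraphHom A B
  have hadj : (cosetGraph A B).Adj (.inl ((1 : G) : G ⧸ A)) (.inr ((1 : G) : G ⧸ B)) :=
    .inl ⟨1, rfl, rfl⟩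
  refine ⟨(G ⧸ A) ⊕ (G ⧸ B), inferInstance, cosetGraph A B, φ.range, _, _,
    cosetGraph_connected hAB, cosetGraph_isLocallyTransitive A B, ⟨_, _, hadj, ?_, ?_⟩, hadj, ?_⟩
  · refine permIsomorphic_localGroup φ hadj ω₁ α ?_ ?_ (exists_mem_apply_eq ht₁ ω₁)
      (fun w hw => cosetGraph_exists_smul hadj hw) ?_
    · simp only [φ, cosetGraphHom_apply, smul_inl_one_eq_iff]
      exact fun a b ha hb => hα a ha b hb
    · simpa only [φ, cosetGraphHom_apply, smul_inl_one_eq_iff] using hαL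
    · simpa only [φ, cosetGraphHom_apply, smul_inl_one_eq_iff, smul_inr_one_eq_iff] using hαs
  · refine permIsomorphic_localGroup φ hadj.symm ω₂ β ?_ ?_ (exists_mem_apply_eq ht₂ ω₂)
      (fun w hw => cosetGraph_exists_smul hadj.symm hw) ?_
    · simp only [φ, cosetGraphHom_apply, smul_inr_one_eq_iff]
      exact fun a b ha hb => hβ a ha b hb
    · simpa only [φ, cosetGraphHom_apply, smul_inr_one_eq_iff] using hβL
    · simpa only [φ, cosetGraphHom_apply, smul_inl_one_eq_iff, smul_inr_one_eq_iff] using hβs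
  · have hker : φ.ker ⊓ M = ⊥ := by
      refine hcore _ (fun g hg => ?_) (fun a _ x hx => φ.normal_ker.conj_mem x hx a)
        (fun a _ x hx => φ.normal_ker.conj_mem x hx a)
      have hfix : ∀ x, g • x = x := fun x => by
        have : φ g x = x := by rw [MonoidHom.mem_ker.1 hg]; rfl
        exact this
      exact ⟨(smul_inl_one_eq_iff (B := B) g).1 (hfix _), (smul_inr_one_eq_iff (A := A) g).1 (hfix _)⟩
    have : Finite (cosetGraph A B ≃g cosetGraph A B) := Finite.of_injective
      (fun f => (f : _ → _)) DFunLike.coe_injective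
    refine Nat.card_le_card_of_injective (fun m : M => (⟨⟨φ m, m, rfl⟩,
      (smul_inl_one_eq_iff _).2 (hM m.2).1, (smul_inr_one_eq_iff _).2 (hM m.2).2⟩ :
        edgeStabilizer φ.range (Sum.inl ((1 : G) : G ⧸ A)) (Sum.inr ((1 : G) : G ⧸ B)))) ?_
    intro m m' h
    have h1 : φ m = φ m' := congrArg (fun x => (x.1.1 : cosetGraph A B ≃g cosetGraph A B)) h
    have h2 : (m'⁻¹ * m : M).1 ∈ φ.ker ⊓ M := by
      refine ⟨MonoidHom.mem_ker.2 ?_, (m'⁻¹ * m : M).2⟩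
      simp [h1]
    rw [hker, Subgroup.mem_bot] at h2
    exact (inv_mul_eq_one.1 (Subtype.ext h2)).symm

end CosetGraph

/-! ### Permutational wreath products -/

section Wreath

/-- The permutational wreath product `P ≀ Sym(Z)`: the pair `(val, perm)` stands for the
permutation of `P × Z` that maps the fibre over `z` to the fibre over `perm z` and acts between
these two copies of `P` as left multiplication by `val z`. -/
@[ext] structure Wreath (P Z : Type*) where
  val : Z → P
  perm : Equiv.Perm Z

variable {P Z : Type*} [Group P]

namespace Wreath

instance : Mul (Wreath P Z) := ⟨fun a b => ⟨fun z => a.val (b.perm z) * b.val z, a.perm * b.perm⟩⟩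
instance : One (Wreath P Z) := ⟨⟨1, 1⟩⟩
instance : Inv (Wreath P Z) := ⟨fun a => ⟨fun z => (a.val (a.perm⁻¹ z))⁻¹, a.perm⁻¹⟩⟩

@[simp] theorem mul_val (a b : Wreath P Z) (z : Z) :
    (a * b).val z = a.val (b.perm z) * b.val z := rfl
@[simp] theorem mul_perm (a b : Wreath P Z) : (a * b).perm = a.perm * b.perm := rfl
@[simp] theorem one_val (z : Z) : (1 : Wreath P Z).val z = 1 := rfl
@[simp] theorem one_perm : (1 : Wreath P Z).perm = 1 := rfl
@[simp] theorem inv_val (a : Wreath P Z) (z : Z) : a⁻¹.val z = (a.val (a.perm⁻¹ z))⁻¹ := rfl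
@[simp] theorem inv_perm (a : Wreath P Z) : a⁻¹.perm = a.perm⁻¹ := rfl

instance : Group (Wreath P Z) := Group.ofLeftAxioms
  (fun a b c => by ext <;> simp [mul_assoc])
  (fun a => by ext <;> simp)
  (fun a => by ext <;> simp)

instance [Finite P] [Finite Z] : Finite (Wreath P Z) :=
  Finite.of_injective (fun a => (a.val, a.perm)) fun a b h => by
    simp only [Prod.mk.injEq] at h
    exact Wreath.ext h.1 h.2

end Wreath

end Wreath

/-! ### The index set and its two actions -/

section Cycle

variable {X Y : Type*} {n : ℕ}

/-- The action of `Sym(X) × Sym(Y)` on `n` copies of `X × Y` and one additional fixed point. -/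
def gridPerm (n : ℕ) : Equiv.Perm X × Equiv.Perm Y →* Equiv.Perm (Option (X × Y × Fin n)) where
  toFun t := Equiv.optionCongr (t.1.prodCongr (t.2.prodCongr (Equiv.refl _)))
  map_one' := by ext1 (_ | _) <;> rfl
  map_mul' _ _ := by ext1 (_ | _) <;> rfl

@[simp] theorem gridPerm_none (t : Equiv.Perm X × Equiv.Perm Y) : gridPerm n t none = none := rfl

@[simp] theorem gridPerm_some (t : Equiv.Perm X × Equiv.Perm Y) (x : X) (y : Y) (j : Fin n) :
    gridPerm n t (some (x, y, j)) = some (t.1 x, t.2 y, j) := rfl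

/-- The points `none, (x₀, y₀, 0), …, (x₀, y₀, n - 1)` in this order. -/
def gridLine (x₀ : X) (y₀ : Y) (n : ℕ) : Fin (n + 1) ↪ Option (X × Y × Fin n) where
  toFun := Fin.cases none fun j => some (x₀, y₀, j)
  inj' i j := by
    refine Fin.cases ?_ (fun i => ?_) i <;> refine Fin.cases ?_ (fun j => ?_) j <;> simp

@[simp] theorem gridLine_zero (x₀ : X) (y₀ : Y) : gridLine x₀ y₀ n 0 = none := rfl

@[simp] theorem gridLine_succ (x₀ : X) (y₀ : Y) (j : Fin n) :
    gridLine x₀ y₀ n j.succ = some (x₀, y₀, j) := rfl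

/-- The cycle `none ↦ (x₀, y₀, 0) ↦ … ↦ (x₀, y₀, n - 1) ↦ none`; it fixes all other points. -/
noncomputable def gridCycle (x₀ : X) (y₀ : Y) (n : ℕ) : Equiv.Perm (Option (X × Y × Fin n)) :=
  (finRotate (n + 1)).viaEmbedding (gridLine x₀ y₀ n)

theorem gridCycle_gridLine (x₀ : X) (y₀ : Y) (j : Fin (n + 1)) :
    gridCycle x₀ y₀ n (gridLine x₀ y₀ n j) = gridLine x₀ y₀ n (finRotate (n + 1) j) :=
  Equiv.Perm.viaEmbedding_apply _ _ _

theorem gridCycle_castSucc (x₀ : X) (y₀ : Y) (j : Fin n) :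
    gridCycle x₀ y₀ n (gridLine x₀ y₀ n j.castSucc) = gridLine x₀ y₀ n j.succ := by
  rw [gridCycle_gridLine, finRotate_apply, Fin.coeSucc_eq_succ]

theorem gridCycle_of_notMem {x₀ : X} {y₀ : Y} {z : Option (X × Y × Fin n)}
    (hz : z ∉ Set.range (gridLine x₀ y₀ n)) : gridCycle x₀ y₀ n z = z :=
  Equiv.Perm.viaEmbedding_apply_of_notMem _ _ _ hz

theorem gridCycle_some_of_ne {x₀ x : X} {y₀ y : Y} (h : x ≠ x₀ ∨ y ≠ y₀) (j : Fin n) :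
    gridCycle x₀ y₀ n (some (x, y, j)) = some (x, y, j) := by
  refine gridCycle_of_notMem ?_
  rintro ⟨i, hi⟩
  revert hi
  refine Fin.cases ?_ (fun i => ?_) i
  · simp
  · simp only [gridLine_succ, Option.some.injEq, Prod.mk.injEq]
    rintro ⟨rfl, rfl, -⟩
    simp at h

theorem gridCycle_commute {x₀ : X} {y₀ : Y} {t : Equiv.Perm X × Equiv.Perm Y}
    (hx : t.1 x₀ = x₀) (hy : t.2 y₀ = y₀) : Commute (gridCycle x₀ y₀ n) (gridPerm n t) := by
  have hfix : ∀ j, gridPerm n t (gridLine x₀ y₀ n j) = gridLine x₀ y₀ n j :=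
    Fin.cases rfl fun j => by simp [hx, hy]
  ext1 z
  rw [Equiv.Perm.mul_apply, Equiv.Perm.mul_apply]
  by_cases hz : z ∈ Set.range (gridLine x₀ y₀ n)
  · obtain ⟨j, rfl⟩ := hz
    rw [hfix, gridCycle_gridLine, hfix]
  · rw [gridCycle_of_notMem hz, gridCycle_of_notMem]
    rintro ⟨j, hj⟩
    rw [← hfix] at hj
    exact hz ⟨j, (gridPerm n t).injective hj⟩

/-- The `X`-coordinate, with the additional point placed over `x₀`. -/
def gridFst (x₀ : X) : Option (X × Y × Fin n) → X
  | none => x₀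
  | some t => t.1

theorem gridFst_gridLine (x₀ : X) (y₀ : Y) (j : Fin (n + 1)) :
    gridFst x₀ (gridLine x₀ y₀ n j) = x₀ :=
  Fin.cases rfl (fun _ => rfl) j

@[simp] theorem gridFst_gridCycle (x₀ : X) (y₀ : Y) (z : Option (X × Y × Fin n)) :
    gridFst x₀ (gridCycle x₀ y₀ n z) = gridFst x₀ z := by
  by_cases hz : z ∈ Set.range (gridLine x₀ y₀ n)
  · obtain ⟨j, rfl⟩ := hz
    rw [gridCycle_gridLine, gridFst_gridLine, gridFst_gridLine]
  · rw [gridCycle_of_notMem hz]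

@[simp] theorem gridFst_gridCycle_symm (x₀ : X) (y₀ : Y) (z : Option (X × Y × Fin n)) :
    gridFst x₀ ((gridCycle x₀ y₀ n)⁻¹ z) = gridFst x₀ z :=
  (gridFst_gridCycle x₀ y₀ _).symm.trans (congrArg _ (Equiv.apply_symm_apply _ _))

theorem gridFst_gridPerm {x₀ : X} (t : Equiv.Perm X × Equiv.Perm Y) {z : Option (X × Y × Fin n)}
    (h : z ≠ none ∨ t.1 x₀ = x₀) : gridFst x₀ (gridPerm n t z) = t.1 (gridFst x₀ z) := by
  rcases z with _ | ⟨x, y, j⟩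
  · exact (h.resolve_left (· rfl)).symm
  · rfl

end Cycle

/-! ### The amalgam -/

section Amalgam

variable {P Ω X Y : Type*} [Group P]

/-- The group containing the two vertex stabilisers: an element of the wreath product together
with the permutations of `X` and `Y` that it covers. -/
abbrev Ambient (P X Y : Type*) (n : ℕ) : Type _ :=
  Wreath P (Option (X × Y × Fin n)) × Equiv.Perm X × Equiv.Perm Y

variable {n : ℕ}

section LineHom

variable {x₀ : X} {y₀ : Y}

open Classical in
/-- The elements of the ambient group that act on the fibres over `(x₀, y₀, j)` only, by elements
of `D`. -/
noncomputable def lineHom (D : Subgroup P) (x₀ : X) (y₀ : Y) (n : ℕ) :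
    (Fin n → D) →* Ambient P X Y n where
  toFun d := (⟨fun z => z.elim 1 fun t => if t.1 = x₀ ∧ t.2.1 = y₀ then d t.2.2 else 1, 1⟩, 1)
  map_one' := by
    refine Prod.ext (Wreath.ext (funext ?_) rfl) rfl
    rintro (_ | t) <;> simp
  map_mul' d d' := by
    refine Prod.ext (Wreath.ext (funext ?_) rfl) (mul_one 1).symm
    rintro (_ | t)
    · simp
    · by_cases h : t.1 = x₀ ∧ t.2.1 = y₀ <;> simp [h]

@[simp] theorem lineHom_val_gridLine (D : Subgroup P) (d : Fin n → D) (j : Fin n) :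
    (lineHom D x₀ y₀ n d).1.val (gridLine x₀ y₀ n j.succ) = d j := by
  simp [lineHom]

theorem lineHom_injective (D : Subgroup P) : Function.Injective (lineHom D x₀ y₀ n) := by
  intro d d' h
  funext j
  have := congrArg (fun w : Ambient P X Y n => w.1.val (gridLine x₀ y₀ n j.succ)) h
  simp only [lineHom_val_gridLine] at this
  exact Subtype.ext this

end LineHom

variable [MulAction P Ω]

/-- `w` maps the marked point `s (gridFst x₀ z)` of the fibre over `z` to the marked point of the
image of this fibre. -/
def FixesMark (s : X → Ω) (x₀ : X) (w : Ambient P X Y n) (z : Option (X × Y × Fin n)) : Prop :=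
  w.1.val z • s (gridFst x₀ z) = s (gridFst x₀ (w.1.perm z))

theorem fixesMark_one (s : X → Ω) (x₀ : X) (z) : FixesMark s x₀ (1 : Ambient P X Y n) z :=
  one_smul P _

theorem FixesMark.mul {s : X → Ω} {x₀ : X} {v w : Ambient P X Y n} {z}
    (hv : FixesMark s x₀ v (w.1.perm z)) (hw : FixesMark s x₀ w z) : FixesMark s x₀ (v * w) z := by
  simp only [FixesMark, Prod.fst_mul, Wreath.mul_val, mul_smul, Wreath.mul_perm,
    Equiv.Perm.mul_apply] at *
  rw [hw, hv]

theorem FixesMark.inv {s : X → Ω} {x₀ : X} {w : Ambient P X Y n} {z}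
    (hw : FixesMark s x₀ w (w.1.perm⁻¹ z)) : FixesMark s x₀ w⁻¹ z := by
  simp only [FixesMark, Prod.fst_inv, Wreath.inv_val, Wreath.inv_perm] at *
  rw [inv_smul_eq_iff, hw]
  exact congrArg (fun z => s (gridFst x₀ z)) (w.1.perm.apply_symm_apply z).symm

variable [MulAction P X]

/-- All components of `w` induce on `X` the permutation recorded by `w`. -/
def IsCoherent (w : Ambient P X Y n) : Prop := ∀ z (x : X), w.1.val z • x = w.2.1 x

theorem isCoherent_one : IsCoherent (1 : Ambient P X Y n) := fun _ x => one_smul P x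

theorem IsCoherent.mul {v w : Ambient P X Y n} (hv : IsCoherent v) (hw : IsCoherent w) :
    IsCoherent (v * w) := fun z x => by
  rw [Prod.fst_mul, Wreath.mul_val, mul_smul, hw z x, hv]
  rfl

theorem IsCoherent.inv {w : Ambient P X Y n} (hw : IsCoherent w) : IsCoherent w⁻¹ := fun z x => by
  simp only [Prod.fst_inv, Wreath.inv_val, Prod.snd_inv]
  rw [inv_smul_eq_iff, hw]
  exact (w.2.1.apply_symm_apply x).symm

variable (P) (L : Subgroup (Equiv.Perm Y)) (s : X → Ω) (x₀ : X) (y₀ : Y) (n)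

/-- The stabiliser of a vertex of the first kind. It acts on `Ω` through the component at `none`,
where no marked point has to be fixed. -/
def firstStabilizer : Subgroup (Ambient P X Y n) where
  carrier := {w | IsCoherent w ∧ w.2.2 ∈ L ∧ w.2.2 y₀ = y₀ ∧ w.1.perm = gridPerm n w.2 ∧
    ∀ z, z ≠ none → FixesMark s x₀ w z}
  one_mem' := ⟨isCoherent_one, L.one_mem, rfl, (map_one _).symm, fun z _ => fixesMark_one s x₀ z⟩
  mul_mem' := by
    rintro v w ⟨hv₁, hv₂, hv₃, hv₄, hv₅⟩ ⟨hw₁, hw₂, hw₃, hw₄, hw₅⟩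
    refine ⟨hv₁.mul hw₁, L.mul_mem hv₂ hw₂, ?_, ?_, fun z hz => (hv₅ _ ?_).mul (hw₅ z hz)⟩
    · rw [Prod.snd_mul, Prod.snd_mul, Equiv.Perm.mul_apply, hw₃, hv₃]
    · rw [Prod.fst_mul, Wreath.mul_perm, hv₄, hw₄, Prod.snd_mul, map_mul]
    · rw [hw₄]
      exact fun h => hz ((gridPerm n w.2).injective h)
  inv_mem' := by
    rintro w ⟨hw₁, hw₂, hw₃, hw₄, hw₅⟩
    refine ⟨hw₁.inv, L.inv_mem hw₂, ?_, ?_, fun z hz => (hw₅ _ ?_).inv⟩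
    · rw [Prod.snd_inv, Prod.snd_inv, Equiv.Perm.inv_eq_iff_eq, hw₃]
    · rw [Prod.fst_inv, Wreath.inv_perm, hw₄, Prod.snd_inv, map_inv]
    · rw [hw₄, ← map_inv]
      exact fun h => hz ((gridPerm n w.2⁻¹).injective h)

/-- The stabiliser of a vertex of the second kind. It fixes all marked points, and acts on `Y`.
The conjugation by `gridCycle` is what distinguishes its action on the index set from that of
`firstStabilizer`. -/
def secondStabilizer : Subgroup (Ambient P X Y n) where
  carrier := {w | IsCoherent w ∧ w.2.2 ∈ L ∧ w.2.1 x₀ = x₀ ∧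
    w.1.perm = (gridCycle x₀ y₀ n)⁻¹ * gridPerm n w.2 * gridCycle x₀ y₀ n ∧
    ∀ z, FixesMark s x₀ w z}
  one_mem' := ⟨isCoherent_one, L.one_mem, rfl, by simp, fixesMark_one s x₀⟩
  mul_mem' := by
    rintro v w ⟨hv₁, hv₂, hv₃, hv₄, hv₅⟩ ⟨hw₁, hw₂, hw₃, hw₄, hw₅⟩
    refine ⟨hv₁.mul hw₁, L.mul_mem hv₂ hw₂, ?_, ?_, fun z => (hv₅ _).mul (hw₅ z)⟩
    · rw [Prod.snd_mul, Prod.fst_mul, Equiv.Perm.mul_apply, hw₃, hv₃]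
    · rw [Prod.fst_mul, Wreath.mul_perm, hv₄, hw₄, Prod.snd_mul, map_mul]
      group
  inv_mem' := by
    rintro w ⟨hw₁, hw₂, hw₃, hw₄, hw₅⟩
    refine ⟨hw₁.inv, L.inv_mem hw₂, ?_, ?_, fun z => (hw₅ _).inv⟩
    · rw [Prod.snd_inv, Prod.fst_inv, Equiv.Perm.inv_eq_iff_eq, hw₃]
    · rw [Prod.fst_inv, Wreath.inv_perm, hw₄, Prod.snd_inv, map_inv]
      group

variable {P L s x₀ y₀ n}

theorem firstStabilizer_mem_second_iff {π : Ω → X} (hπ : ∀ (g : P) ω, π (g • ω) = g • π ω)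
    (hs : ∀ x, π (s x) = x) {w : Ambient P X Y n} (hw : w ∈ firstStabilizer P n L s x₀ y₀) :
    w ∈ secondStabilizer P n L s x₀ y₀ ↔ w.1.val none • s x₀ = s x₀ := by
  obtain ⟨hw₁, hw₂, hw₃, hw₄, hw₅⟩ := hw
  constructor
  · rintro ⟨-, -, -, -, h⟩
    have := h none
    rwa [FixesMark, hw₄, gridPerm_none] at this
  · intro h
    have hx : w.2.1 x₀ = x₀ := by
      rw [← hw₁ none]
      conv_lhs => rw [← hs x₀, ← hπ, h, hs]
    refine ⟨hw₁, hw₂, hx, ?_, fun z => ?_⟩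
    · rw [hw₄, mul_assoc, ← (gridCycle_commute hx hw₃).eq, inv_mul_cancel_left]
    · rcases eq_or_ne z none with rfl | hz
      · rw [FixesMark, hw₄, gridPerm_none]
        exact h
      · exact hw₅ z hz

theorem secondStabilizer_mem_first_iff {w : Ambient P X Y n}
    (hw : w ∈ secondStabilizer P n L s x₀ y₀) :
    w ∈ firstStabilizer P n L s x₀ y₀ ↔ w.2.2 y₀ = y₀ := by
  obtain ⟨hw₁, hw₂, hw₃, hw₄, hw₅⟩ := hw
  refine ⟨fun h => h.2.2.1, fun h => ⟨hw₁, hw₂, h, ?_, fun z _ => hw₅ z⟩⟩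
  rw [hw₄, mul_assoc, ← (gridCycle_commute hw₃ h).eq, inv_mul_cancel_left]

theorem exists_mem_firstStabilizer
    (hlift : ∀ (g : P) (x : X), ∃ h : P, (∀ x' : X, h • x' = g • x') ∧ h • s x = s (g • x)) (g : P) :
    ∃ w ∈ firstStabilizer P n L s x₀ y₀,
      w.1.val none = g ∧ w.2.1 = MulAction.toPerm g ∧ w.2.2 = 1 := by
  choose h hX hs using hlift g
  refine ⟨(⟨fun z => z.elim g fun t => h t.1, gridPerm n (MulAction.toPerm g, 1)⟩,
    MulAction.toPerm g, 1), ⟨?_, L.one_mem, rfl, rfl, ?_⟩, rfl, rfl, rfl⟩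
  · rintro (_ | ⟨x, y, j⟩) x'
    exacts [rfl, hX x x']
  · rintro (_ | ⟨x, y, j⟩) hz
    exacts [absurd rfl hz, hs x]

theorem exists_mem_secondStabilizer {μ : Equiv.Perm Y} (hμ : μ ∈ L) :
    ∃ w ∈ secondStabilizer P n L s x₀ y₀, w.2 = (1, μ) := by
  refine ⟨(⟨1, (gridCycle x₀ y₀ n)⁻¹ * gridPerm n (1, μ) * gridCycle x₀ y₀ n⟩, 1, μ),
    ⟨fun _ x => one_smul P x, hμ, rfl, rfl, fun z => ?_⟩, rfl⟩
  simp only [FixesMark, Pi.one_apply, one_smul, Equiv.Perm.mul_apply, gridFst_gridCycle_symm]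
  rw [gridFst_gridPerm _ (.inr rfl), gridFst_gridCycle]
  rfl

/-- The permutations of the index set induced by the two stabilisers link consecutive points of
`gridLine`: `μ ∈ L` moves `y₀` away, `g` then moves `x₀` away, and away from `x₀` the element
`μ⁻¹` of the second stabiliser acts naturally. -/
theorem gridLine_step (hlift : ∀ (g : P) (x : X), ∃ h : P,
      (∀ x' : X, h • x' = g • x') ∧ h • s x = s (g • x))
    {g : P} (hg : g • x₀ ≠ x₀) {μ : Equiv.Perm Y} (hμ : μ ∈ L) (hμy : μ y₀ ≠ y₀)
    (Q : Option (X × Y × Fin n) → Prop)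
    (hQ₁ : ∀ u ∈ firstStabilizer P n L s x₀ y₀, ∀ z, Q z → Q (u.1.perm z))
    (hQ₂ : ∀ u ∈ secondStabilizer P n L s x₀ y₀, ∀ z, Q z → Q (u.1.perm z))
    (j : Fin n) (hj : Q (gridLine x₀ y₀ n j.castSucc)) : Q (gridLine x₀ y₀ n j.succ) := by
  obtain ⟨a, ha, -, ha₁, ha₂⟩ := exists_mem_firstStabilizer (L := L) (x₀ := x₀) (y₀ := y₀)
    (n := n) hlift g
  obtain ⟨b, hb, hb'⟩ := exists_mem_secondStabilizer (P := P) (s := s) (x₀ := x₀) (y₀ := y₀)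
    (n := n) hμ
  have hap := ha.2.2.2.1
  have hbp := hb.2.2.2.1
  have haa : a.2 = (MulAction.toPerm g, 1) := Prod.ext ha₁ ha₂
  have h₁ := hQ₂ b hb _ hj
  rw [hbp, hb', Equiv.Perm.mul_apply, Equiv.Perm.mul_apply, gridCycle_castSucc, gridLine_succ,
    gridPerm_some, Equiv.Perm.inv_eq_iff_eq.2 (gridCycle_some_of_ne (.inr hμy) j).symm] at h₁
  have h₂ := hQ₁ a ha _ h₁
  rw [hap, haa, gridPerm_some] at h₂
  have h₃ := hQ₂ b⁻¹ (inv_mem hb) _ h₂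
  have h₄ := hQ₁ a⁻¹ (inv_mem ha) _ h₃
  have e₁ : b⁻¹.1.perm (some (g • x₀, μ y₀, j)) = some (g • x₀, y₀, j) := by
    rw [Prod.fst_inv, Wreath.inv_perm, Equiv.Perm.inv_eq_iff_eq, hbp, hb', Equiv.Perm.mul_apply,
      Equiv.Perm.mul_apply, gridCycle_some_of_ne (.inl hg), gridPerm_some, eq_comm,
      Equiv.Perm.inv_eq_iff_eq]
    exact (gridCycle_some_of_ne (.inl hg) j).symm
  have e₂ : a⁻¹.1.perm (some (g • x₀, y₀, j)) = some (x₀, y₀, j) := by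
    rw [Prod.fst_inv, Wreath.inv_perm, Equiv.Perm.inv_eq_iff_eq, hap, haa]
    rfl
  change Q (a⁻¹.1.perm (b⁻¹.1.perm (some (g • x₀, μ y₀, j)))) at h₄
  rwa [e₁, e₂] at h₄

/-- A subgroup of the edge stabiliser normalised by both vertex stabilisers has trivial
components along `gridLine` at elements that fix the index set. At `none` this holds because the
point stabilisers of the faithful transitive group `P` have trivial intersection. -/
theorem val_gridLine_eq_one [FaithfulSMul P Ω] [MulAction.IsPretransitive P Ω]
    (hlift : ∀ (g : P) (x : X), ∃ h : P, (∀ x' : X, h • x' = g • x') ∧ h • s x = s (g • x))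
    {g : P} (hg : g • x₀ ≠ x₀) {μ : Equiv.Perm Y} (hμ : μ ∈ L) (hμy : μ y₀ ≠ y₀)
    {N : Subgroup (Ambient P X Y n)} (hN₂ : N ≤ secondStabilizer P n L s x₀ y₀)
    (hA : ∀ a ∈ firstStabilizer P n L s x₀ y₀, ∀ x ∈ N, a * x * a⁻¹ ∈ N)
    (hB : ∀ b ∈ secondStabilizer P n L s x₀ y₀, ∀ x ∈ N, b * x * b⁻¹ ∈ N)
    {w : Ambient P X Y n} (hw : w ∈ N) (hp : w.1.perm = 1) (j : Fin (n + 1)) :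
    w.1.val (gridLine x₀ y₀ n j) = 1 := by
  let Q : Option (X × Y × Fin n) → Prop := fun z => ∀ w ∈ N, w.1.perm = 1 → w.1.val z = 1
  have hconj : ∀ u : Ambient P X Y n, (∀ x ∈ N, u⁻¹ * x * u⁻¹⁻¹ ∈ N) →
      ∀ z, Q z → Q (u.1.perm z) := by
    intro u hu z hz w hw hp
    have := hz _ (hu w hw) (by simp [hp])
    simpa [hp, mul_assoc, inv_mul_eq_one] using this
  suffices h : ∀ j, Q (gridLine x₀ y₀ n j) from h j w hw hp
  intro j
  induction j using Fin.induction with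
  | zero =>
    intro w hw hp
    rw [gridLine_zero]
    refine FaithfulSMul.eq_of_smul_eq_smul (α := Ω) fun ω => ?_
    obtain ⟨k, rfl⟩ := MulAction.exists_smul_eq P (s x₀) ω
    obtain ⟨a, ha, rfl, -⟩ := exists_mem_firstStabilizer (L := L) (x₀ := x₀) (y₀ := y₀)
      (n := n) hlift k
    have h := (hN₂ (hA a⁻¹ (inv_mem ha) w hw)).2.2.2.2 none
    have hap : a.1.perm none = none := by rw [ha.2.2.2.1]; rfl
    simp only [FixesMark, inv_inv, Prod.fst_mul, Prod.fst_inv, Wreath.mul_val, Wreath.inv_val,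
      Wreath.mul_perm, Wreath.inv_perm, hp, mul_one, inv_mul_cancel, Equiv.Perm.one_apply, hap,
      Equiv.Perm.inv_eq_iff_eq.2 hap.symm, mul_smul] at h
    rw [one_smul]
    exact inv_smul_eq_iff.1 h
  | succ j ih =>
    exact gridLine_step hlift hg hμ hμy Q
      (fun u hu => hconj u fun x hx => hA _ (inv_mem hu) x hx)
      (fun u hu => hconj u fun x hx => hB _ (inv_mem hu) x hx) j ih

theorem lineHom_mem {D : Subgroup P} (hD : ∀ g ∈ D, (∀ x : X, g • x = x) ∧ g • s x₀ = s x₀)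
    (d : Fin n → D) : lineHom D x₀ y₀ n d ∈
      firstStabilizer P n L s x₀ y₀ ⊓ secondStabilizer P n L s x₀ y₀ := by
  have hm : ∀ z, FixesMark s x₀ (lineHom D x₀ y₀ n d) z := by
    rintro (_ | ⟨x, y, j⟩)
    · exact one_smul P _
    · by_cases h : x = x₀ ∧ y = y₀
      · obtain ⟨rfl, rfl⟩ := h
        simpa [FixesMark, lineHom, gridFst] using (hD _ (d j).2).2
      · simp [FixesMark, lineHom, gridFst, h]
  have hc : IsCoherent (lineHom D x₀ y₀ n d) := by
    rintro (_ | ⟨x, y, j⟩) x'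
    · exact one_smul P _
    · by_cases h : x = x₀ ∧ y = y₀
      · simpa [lineHom, h] using (hD _ (d j).2).1 x'
      · simp [lineHom, h]
  exact ⟨⟨hc, L.one_mem, rfl, (map_one _).symm, fun z _ => hm z⟩,
    ⟨hc, L.one_mem, rfl, by simp [lineHom], hm⟩⟩

end Amalgam

/-! ### Locally restrictive pairs -/

theorem IsLocallyRestrictive.symm {Ω₁ Ω₂ : Type*} {L₁ : Subgroup (Equiv.Perm Ω₁)}
    {L₂ : Subgroup (Equiv.Perm Ω₂)} (h : IsLocallyRestrictive L₁ L₂) :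
    IsLocallyRestrictive L₂ L₁ := by
  obtain ⟨c, hc⟩ := h
  refine ⟨c, fun V _ Γ G hΓ hG ⟨u, v, huv, hu, hv⟩ => hc V Γ G hΓ hG ⟨v, u, huv.symm, hv, hu⟩⟩

/-- The version of `exists_locally_of_sup_eq_top` for subgroups `A` and `B` of any finite group. -/
theorem exists_locally_of_subgroups {G : Type} [Group G] [Finite G] {Ω₁ Ω₂ : Type*}
    {L₁ : Subgroup (Equiv.Perm Ω₁)} {L₂ : Subgroup (Equiv.Perm Ω₂)}
    (ht₁ : MulAction.IsPretransitive L₁ Ω₁) (ht₂ : MulAction.IsPretransitive L₂ Ω₂)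
    {A B : Subgroup G} (ω₁ : Ω₁) (ω₂ : Ω₂)
    (α : G → Equiv.Perm Ω₁) (β : G → Equiv.Perm Ω₂)
    (hα : ∀ a ∈ A, ∀ b ∈ A, α (a * b) = α a * α b)
    (hβ : ∀ a ∈ B, ∀ b ∈ B, β (a * b) = β a * β b)
    (hαL : ∀ σ, σ ∈ L₁ ↔ ∃ a ∈ A, α a = σ) (hβL : ∀ σ, σ ∈ L₂ ↔ ∃ b ∈ B, β b = σ)
    (hαs : ∀ a ∈ A, (a ∈ B ↔ α a ω₁ = ω₁)) (hβs : ∀ b ∈ B, (b ∈ A ↔ β b ω₂ = ω₂))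
    (M : Subgroup G) (hM : M ≤ A ⊓ B)
    (hcore : ∀ N : Subgroup G, N ≤ A ⊓ B → (∀ a ∈ A, ∀ x ∈ N, a * x * a⁻¹ ∈ N) →
      (∀ b ∈ B, ∀ x ∈ N, b * x * b⁻¹ ∈ N) → N ⊓ M = ⊥) :
    ∃ (V : Type) (_ : Finite V) (Γ : SimpleGraph V) (H : Subgroup (Γ ≃g Γ)) (u v : V),
      Γ.Connected ∧ IsLocallyTransitive H ∧ IsLocally H L₁ L₂ ∧ Γ.Adj u v ∧
      Nat.card M ≤ Nat.card (edgeStabilizer H u v) := by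
  have hA : A ≤ A ⊔ B := le_sup_left
  have hB : B ≤ A ⊔ B := le_sup_right
  have hMAB : M ≤ A ⊔ B := hM.trans (inf_le_left.trans hA)
  rw [← Nat.card_congr (Subgroup.subgroupOfEquivOfLe hMAB).toEquiv]
  refine exists_locally_of_sup_eq_top ht₁ ht₂ (A := A.subgroupOf (A ⊔ B))
    (B := B.subgroupOf (A ⊔ B)) ?_ ω₁ ω₂ (fun g => α g) (fun g => β g)
    (fun a ha b hb => hα a ha b hb) (fun a ha b hb => hβ a ha b hb) (fun σ => ?_) (fun σ => ?_)
    (fun a ha => hαs a ha) (fun b hb => hβs b hb) _ (fun m hm => hM hm) (fun N hN hNA hNB => ?_)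
  · rw [← Subgroup.subgroupOf_sup hA hB, Subgroup.subgroupOf_self]
  · rw [hαL]
    exact ⟨fun ⟨a, ha, h⟩ => ⟨⟨a, hA ha⟩, ha, h⟩, fun ⟨a, ha, h⟩ => ⟨a, ha, h⟩⟩
  · rw [hβL]
    exact ⟨fun ⟨a, ha, h⟩ => ⟨⟨a, hB ha⟩, ha, h⟩, fun ⟨a, ha, h⟩ => ⟨a, ha, h⟩⟩
  · have h := hcore (N.map (A ⊔ B).subtype)
      (by rintro _ ⟨x, hx, rfl⟩; exact hN hx)
      (by rintro a ha _ ⟨x, hx, rfl⟩; exact ⟨_, hNA ⟨a, hA ha⟩ ha x hx, rfl⟩)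
      (by rintro a ha _ ⟨x, hx, rfl⟩; exact ⟨_, hNB ⟨a, hB ha⟩ ha x hx, rfl⟩)
    rw [eq_bot_iff] at h ⊢
    rintro x ⟨hx, hxM⟩
    exact Subtype.ext (h ⟨⟨x, hx, rfl⟩, hxM⟩)

section Main

variable {Ω Y : Type} [Finite Ω] [Finite Y]
  {L₁ : Subgroup (Equiv.Perm Ω)} {L₂ : Subgroup (Equiv.Perm Y)}

/-- The amalgam of `firstStabilizer` and `secondStabilizer` applied to an invariant map
`π : Ω → X` with section `s`, whose kernel is transitive on the fibres (`hlift`) and contains an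
element `d ≠ 1` that fixes a point. -/
theorem not_isLocallyRestrictive_of_quotient
    (ht₁ : MulAction.IsPretransitive L₁ Ω) (ht₂ : MulAction.IsPretransitive L₂ Y)
    (hL₂ : Nontrivial L₂) {X : Type} [Finite X] [MulAction L₁ X] (π : Ω → X)
    (hπ : ∀ (g : L₁) ω, π (g • ω) = g • π ω) (s : X → Ω) (hs : ∀ x, π (s x) = x)
    (hlift : ∀ (g : L₁) (x : X), ∃ h : L₁, (∀ x' : X, h • x' = g • x') ∧ h • s x = s (g • x))
    {x₀ : X} {g : L₁} (hg : g • x₀ ≠ x₀) {d : L₁} (hd : d ≠ 1) (hdX : ∀ x : X, d • x = x)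
    (hds : d • s x₀ = s x₀) : ¬ IsLocallyRestrictive L₁ L₂ := by
  rintro ⟨c, hc⟩
  obtain ⟨⟨μ, hμ⟩, hμ1⟩ := exists_ne (1 : L₂)
  obtain ⟨y₀, hμy⟩ : ∃ y₀, μ y₀ ≠ y₀ := by
    by_contra! h
    exact hμ1 (Subtype.ext (Equiv.ext h))
  let D : Subgroup L₁ := (MulAction.toPermHom L₁ X).ker ⊓ MulAction.stabilizer L₁ (s x₀)
  have hD : ∀ k ∈ D, (∀ x : X, k • x = x) ∧ k • s x₀ = s x₀ := fun k hk =>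
    ⟨fun x => congrArg (fun σ : Equiv.Perm X => σ x) (MonoidHom.mem_ker.1 hk.1), hk.2⟩
  have hdD : d ∈ D := ⟨MonoidHom.mem_ker.2 (Equiv.ext hdX), hds⟩
  have : Nontrivial D := ⟨⟨d, hdD⟩, 1, fun h => hd (congrArg Subtype.val h)⟩
  obtain ⟨V, hV, Γ, H, u, v, hΓ, hH, hloc, huv, hcard⟩ :=
    exists_locally_of_subgroups ht₁ ht₂ (A := firstStabilizer L₁ c L₂ s x₀ y₀)
      (B := secondStabilizer L₁ c L₂ s x₀ y₀) (s x₀) y₀ (fun w => (w.1.val none : Equiv.Perm Ω))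
      (fun w => w.2.2)
      (fun a _ b hb => by
        change ((a.1.val (b.1.perm none) * b.1.val none : L₁) : Equiv.Perm Ω) = _
        rw [hb.2.2.2.1, gridPerm_none]
        rfl)
      (fun a _ b _ => rfl)
      (fun σ => ⟨fun hσ => by
          obtain ⟨w, hw, h, -⟩ := exists_mem_firstStabilizer (L := L₂) (x₀ := x₀) (y₀ := y₀)
            (n := c) hlift ⟨σ, hσ⟩
          exact ⟨w, hw, congrArg Subtype.val h⟩,
        by rintro ⟨w, -, rfl⟩; exact (w.1.val none).2⟩)
      (fun σ => ⟨fun hσ => by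
          obtain ⟨w, hw, h⟩ := exists_mem_secondStabilizer (P := L₁) (s := s) (x₀ := x₀)
            (y₀ := y₀) (n := c) hσ
          exact ⟨w, hw, congrArg Prod.snd h⟩,
        by rintro ⟨w, hw, rfl⟩; exact hw.2.1⟩)
      (fun w hw => firstStabilizer_mem_second_iff hπ hs hw)
      (fun w hw => secondStabilizer_mem_first_iff hw)
      (lineHom D x₀ y₀ c).range
      (by rintro _ ⟨k, rfl⟩; exact lineHom_mem hD k)
      (fun N hN hA hB => by
        rw [eq_bot_iff]
        rintro _ ⟨hw, k, rfl⟩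
        rw [Subgroup.mem_bot, ← map_one (lineHom D x₀ y₀ c)]
        congr 1
        funext j
        have h := val_gridLine_eq_one hlift hg hμ hμy (hN.trans inf_le_right) hA hB hw rfl j.succ
        rw [lineHom_val_gridLine] at h
        exact Subtype.ext h)
  have h₁ := hcard.trans (hc V Γ H hΓ hH hloc u v huv)
  rw [← Nat.card_congr (MonoidHom.ofInjective (lineHom_injective D)).toEquiv, Nat.card_fun,
    Nat.card_fin] at h₁
  -- The exponent was taken to be `c` because `|D| ^ c ≥ 2 ^ c > c`.
  have h₂ : 2 ^ c ≤ Nat.card D ^ c := Nat.pow_le_pow_left Finite.one_lt_card c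
  exact absurd (h₂.trans h₁) (not_le.2 Nat.lt_two_pow_self)

/-- The action of a group on the set of orbits of a normal subgroup. -/
@[reducible] def orbitQuotientAction {P Ω : Type*} [Group P] [MulAction P Ω] (K : Subgroup P)
    [hK : K.Normal] : MulAction P (MulAction.orbitRel.Quotient K Ω) where
  smul g := Quotient.map' (g • ·) fun a b ⟨k, hk⟩ => by
    refine ⟨⟨g * k * g⁻¹, hK.conj_mem k k.2 g⟩, ?_⟩
    rw [← hk]
    simp [Subgroup.smul_def, mul_smul]
  one_smul := by
    rintro ⟨a⟩
    exact congrArg _ (one_smul P a)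
  mul_smul g h := by
    rintro ⟨a⟩
    exact congrArg _ (mul_smul g h a)

theorem not_isLocallyRestrictive_of_not_isSemiprimitive
    (ht₁ : MulAction.IsPretransitive L₁ Ω) (ht₂ : MulAction.IsPretransitive L₂ Y)
    (hL₂ : Nontrivial L₂) (h : ¬ IsSemiprimitive L₁) : ¬ IsLocallyRestrictive L₁ L₂ := by
  classical
  simp only [IsSemiprimitive, IsSemiregular, not_forall, not_or] at h
  obtain ⟨K, hK, htr, d, ω, hdω, hd⟩ := h
  let X := MulAction.orbitRel.Quotient K Ω
  let _ : MulAction L₁ X := orbitQuotientAction K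
  let π : Ω → X := Quotient.mk''
  have hπeq : ∀ a b, π a = π b ↔ ∃ k : K, k • b = a := fun a b => Quotient.eq''
  -- The marked point of the orbit of `ω` has to be `ω` itself, as `d` fixes `ω`.
  let s : X → Ω := fun x => if x = π ω then ω else x.out
  have hs : ∀ x, π (s x) = x := fun x => by
    by_cases hx : x = π ω
    · simp only [s, hx, if_true]
    · simp only [s, if_neg hx]
      exact Quotient.out_eq' x
  have hπ : ∀ (g : L₁) a, π (g • a) = g • π a := fun _ _ => rfl
  have hKX : ∀ (k : K) (x : X), (k : L₁) • x = x := by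
    rintro k x
    rw [← hs x, ← hπ]
    exact (hπeq _ _).2 ⟨k, rfl⟩
  obtain ⟨ω', hω'⟩ : ∃ ω', π ω' ≠ π ω := by
    by_contra! hall
    refine htr ⟨fun a b => (hπeq b a).1 ?_⟩
    exact (hall b).trans (hall a).symm
  obtain ⟨g, hg⟩ := ht₁.exists_smul_eq ω ω'
  refine not_isLocallyRestrictive_of_quotient ht₁ ht₂ hL₂ π hπ s hs (fun g x => ?_)
    (x₀ := π ω) (g := g) ?_ (d := d) (fun h => hd (Subtype.ext h)) (hKX d) ?_
  · obtain ⟨k, hk⟩ := (hπeq (s (g • x)) (g • s x)).1 (by rw [hs, hπ, hs])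
    exact ⟨k * g, fun x' => by rw [mul_smul, hKX], by rw [mul_smul]; exact hk⟩
  · rwa [← hπ, hg]
  · simp only [s, if_true]
    exact hdω

end Main

/-! ### Change of the permuted set -/

section Transport

theorem PermIsomorphic.trans {Ω Ω' Ω'' : Type*} {L : Subgroup (Equiv.Perm Ω)}
    {M : Subgroup (Equiv.Perm Ω')} {N : Subgroup (Equiv.Perm Ω'')}
    (h : PermIsomorphic L M) (h' : PermIsomorphic M N) : PermIsomorphic L N := by
  obtain ⟨e, he⟩ := h
  obtain ⟨f, hf⟩ := h'
  exact ⟨e.trans f, fun σ => by rw [he, hf]; rfl⟩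

variable {Ω Ω' : Type*}

/-- The permutation group on `Ω'` corresponding to `L` under a bijection `Ω ≃ Ω'`. -/
def transport (e : Ω ≃ Ω') (L : Subgroup (Equiv.Perm Ω)) : Subgroup (Equiv.Perm Ω') :=
  L.map e.permCongrHom.toMonoidHom

variable {L : Subgroup (Equiv.Perm Ω)}

theorem permCongr_mem_transport (e : Ω ≃ Ω') {σ : Equiv.Perm Ω} :
    e.permCongr σ ∈ transport e L ↔ σ ∈ L :=
  Subgroup.mem_map_iff_mem e.permCongrHom.injective

theorem permIsomorphic_transport (e : Ω ≃ Ω') : PermIsomorphic (transport e L) L := by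
  refine ⟨e.symm, fun σ => ?_⟩
  obtain ⟨σ, rfl⟩ := e.permCongr.surjective σ
  rw [permCongr_mem_transport, ← Equiv.permCongr_symm, Equiv.symm_apply_apply]

/-- The isomorphism from `L` to the corresponding permutation group on `Ω'`. -/
noncomputable def transportEquiv (e : Ω ≃ Ω') (L : Subgroup (Equiv.Perm Ω)) :
    L ≃* transport e L :=
  L.equivMapOfInjective _ e.permCongrHom.injective

theorem transportEquiv_smul (e : Ω ≃ Ω') (g : L) (ω : Ω) :
    transportEquiv e L g • e ω = e (g • ω) :=
  congrArg (fun ω => e ((g : Equiv.Perm Ω) ω)) (e.symm_apply_apply ω)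

theorem isPretransitive_transport (e : Ω ≃ Ω') (h : MulAction.IsPretransitive L Ω) :
    MulAction.IsPretransitive (transport e L) Ω' := by
  refine ⟨fun a b => ?_⟩
  obtain ⟨a, rfl⟩ := e.surjective a
  obtain ⟨b, rfl⟩ := e.surjective b
  obtain ⟨g, rfl⟩ := h.exists_smul_eq a b
  exact ⟨transportEquiv e L g, transportEquiv_smul e g a⟩

theorem IsSemiprimitive.of_transport (e : Ω ≃ Ω') (h : IsSemiprimitive (transport e L)) :
    IsSemiprimitive L := by
  intro K hK
  have hK' := hK.map (transportEquiv e L).toMonoidHom (transportEquiv e L).surjective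
  refine (h _ hK').imp (fun htr => ⟨fun a b => ?_⟩) (fun hreg k ω hk => ?_)
  · obtain ⟨⟨_, k, hk, rfl⟩, hab⟩ := htr.exists_smul_eq (e a) (e b)
    exact ⟨⟨k, hk⟩, e.injective ((transportEquiv_smul e k a).symm.trans hab)⟩
  · have h1 := hreg ⟨transportEquiv e L k, k, k.2, rfl⟩ (e ω)
      ((transportEquiv_smul e (k : L) ω).trans (congrArg e hk))
    exact Subtype.ext ((transportEquiv e L).injective
      ((congrArg Subtype.val h1).trans (map_one (transportEquiv e L)).symm))

theorem IsLocallyRestrictive.transport {Ω₁ Ω₂ Ω₁' Ω₂' : Type*} {L₁ : Subgroup (Equiv.Perm Ω₁)}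
    {L₂ : Subgroup (Equiv.Perm Ω₂)} (h : IsLocallyRestrictive L₁ L₂) (e₁ : Ω₁ ≃ Ω₁')
    (e₂ : Ω₂ ≃ Ω₂') :
    IsLocallyRestrictive (LocRes.transport e₁ L₁) (LocRes.transport e₂ L₂) := by
  obtain ⟨c, hc⟩ := h
  exact ⟨c, fun V _ Γ G hΓ hG ⟨u, v, huv, hu, hv⟩ => hc V Γ G hΓ hG
    ⟨u, v, huv, hu.trans (permIsomorphic_transport e₁), hv.trans (permIsomorphic_transport e₂)⟩⟩

end Transport

end LocRes

theorem theorem1p2 {Ω₁ Ω₂ : Type*} [Finite Ω₁] [Finite Ω₂]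
    (L₁ : Subgroup (Equiv.Perm Ω₁)) (L₂ : Subgroup (Equiv.Perm Ω₂))
    (hL₁ : Nontrivial L₁) (hL₂ : Nontrivial L₂)
    (ht₁ : MulAction.IsPretransitive L₁ Ω₁) (ht₂ : MulAction.IsPretransitive L₂ Ω₂)
    (h : ¬ LocRes.IsSemiprimitive L₁ ∨ ¬ LocRes.IsSemiprimitive L₂) :
    ¬ LocRes.IsLocallyRestrictive L₁ L₂ := by
  obtain ⟨n₁, ⟨e₁⟩⟩ := Finite.exists_equiv_fin Ω₁
  obtain ⟨n₂, ⟨e₂⟩⟩ := Finite.exists_equiv_fin Ω₂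
  intro hr
  have hr' := hr.transport e₁ e₂
  have ht₁' := LocRes.isPretransitive_transport e₁ ht₁
  have ht₂' := LocRes.isPretransitive_transport e₂ ht₂
  have hL₁' := (LocRes.transportEquiv e₁ L₁).symm.toEquiv.nontrivial
  have hL₂' := (LocRes.transportEquiv e₂ L₂).symm.toEquiv.nontrivial
  rcases h with h | h
  · exact LocRes.not_isLocallyRestrictive_of_not_isSemiprimitive ht₁' ht₂' hL₂'
      (fun hsp => h (hsp.of_transport e₁)) hr'
  · exact LocRes.not_isLocallyRestrictive_of_not_isSemiprimitive ht₂' ht₁' hL₁'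
      (fun hsp => h (hsp.of_transport e₂)) hr'.symm
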